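/- Let $\alpha$ be a real quadratic irrational, that is, a real root of an irreducible polynomial of degree $2$ with integer coefficients. Let $ax^2+bx+c$ be its minimal polynomial, with $a,b,c\in\mathbb{Z}$, $\gcd(a,b,c)=1$ and $a>0$; let $Q(x,y)=ax^2+bxy+cy^2$ and $D=b^2-4ac$. Write $\|x\|=\min_{k\in\mathbb{Z}}|x-k|$. Then $D>0$, and there is a smallest solution $(t_0,u_0)$ in positive integers of Pell's equation $t^2-Du^2=4$. Put $\varepsilon=(t_0+u_0\sqrt D)/2$, and let $$P_Q=\left\{(x,y)\in\mathbb{Z}^2:\ 2ax+(b-\sqrt D)y>0 \ \text{ and } \ 1\le\left|\frac{2ax+(b+\sqrt D)y}{2ax+(b-\sqrt D)y}\right|<\varepsilon^2\right\}.$$ For each nonzero integer $n$, the set of primary representations $\{(x,y)\in P_Q: Q(x,y)=n\}$ is finite; let $R_Q(n)$ denote its cardinality. For every real $\theta>1$ the series $$c(\alpha,\theta)=\frac{D^{\theta/2}}{\log\varepsilon}\sum_{n\in\mathbb{Z},\,n\ne0}\frac{R_Q(n)}{|n|^\theta}$$ converges, and for every integer $M\ge1$, $$\sum_{m=1}^M\frac{1}{m^\theta\|m\alpha\|^\theta}=c(\alpha,\theta)\log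 M+O(1),$$ with an implied constant depending only on $\alpha$ and $\theta$. -/

import Mathlib

/-- A real number is a quadratic irrational if it is a root of an irreducible polynomial of
degree `2` with integer coefficients. -/
def IsQuadraticIrrational (α : ℝ) : Prop :=
  ∃ p : Polynomial ℤ, Irreducible p ∧ p.natDegree = 2 ∧ Polynomial.aeval α p = 0

/-- The distance from a real number to the nearest integer. -/
noncomputable def distNearestInt (x : ℝ) : ℝ := |x - (round x : ℝ)|

/-- `distNearestInt x` is the minimum of `|x - n|` over the integers `n`. -/
theorem distNearestInt_isLeast (x : ℝ) :
    IsLeast (Set.range fun n : ℤ => |x - (n : ℝ)|) (distNearestInt x) := by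
  refine ⟨⟨round x, rfl⟩, ?_⟩
  rintro _ ⟨n, rfl⟩
  exact round_le x n

/-- The integral binary quadratic form `a x ^ 2 + b x y + c y ^ 2`. -/
structure IntBinaryForm where
  a : ℤ
  b : ℤ
  c : ℤ

namespace IntBinaryForm

/-- The value of the form at `(x, y)`. -/
def eval (Q : IntBinaryForm) (x y : ℤ) : ℤ := Q.a * x ^ 2 + Q.b * x * y + Q.c * y ^ 2

/-- The discriminant. -/
def disc (Q : IntBinaryForm) : ℤ := Q.b ^ 2 - 4 * Q.a * Q.c

/-- The set of primary points of `ℤ ^ 2` for `Q`, relative to the unit `ε`. -/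
def primarySet (Q : IntBinaryForm) (ε : ℝ) : Set (ℤ × ℤ) :=
  {p | 0 < 2 * (Q.a : ℝ) * p.1 + ((Q.b : ℝ) - √(Q.disc : ℝ)) * p.2 ∧
    1 ≤ |(2 * (Q.a : ℝ) * p.1 + ((Q.b : ℝ) + √(Q.disc : ℝ)) * p.2) /
        (2 * (Q.a : ℝ) * p.1 + ((Q.b : ℝ) - √(Q.disc : ℝ)) * p.2)| ∧
    |(2 * (Q.a : ℝ) * p.1 + ((Q.b : ℝ) + √(Q.disc : ℝ)) * p.2) /
        (2 * (Q.a : ℝ) * p.1 + ((Q.b : ℝ) - √(Q.disc : ℝ)) * p.2)| < ε ^ 2}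

/-- The set of primary representations of `n` by `Q`. -/
def primaryReps (Q : IntBinaryForm) (ε : ℝ) (n : ℤ) : Set (ℤ × ℤ) :=
  {p | Q.eval p.1 p.2 = n} ∩ Q.primarySet ε

/-- The number of primary representations of `n` by `Q`. -/
noncomputable def primaryCount (Q : IntBinaryForm) (ε : ℝ) (n : ℤ) : ℕ :=
  (Q.primaryReps ε n).ncard

/-- The constant `D ^ (θ / 2) / log ε * ∑_{n ≠ 0} R_Q(n) / |n| ^ θ`. -/
noncomputable def diophantineConst (Q : IntBinaryForm) (ε θ : ℝ) : ℝ :=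
  (Q.disc : ℝ) ^ (θ / 2) / Real.log ε *
    ∑' n : {n : ℤ // n ≠ 0}, (Q.primaryCount ε n.1 : ℝ) / |(n.1 : ℝ)| ^ θ

end IntBinaryForm

/-- `(t, u)` is the smallest solution of `t ^ 2 - D u ^ 2 = 4` in positive integers. -/
def IsSmallestPellSolution (D t u : ℤ) : Prop :=
  (0 < t ∧ 0 < u ∧ t ^ 2 - D * u ^ 2 = 4) ∧
    ∀ t' u' : ℤ, 0 < t' → 0 < u' → t' ^ 2 - D * u' ^ 2 = 4 → t ≤ t' ∧ u ≤ u'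

/-- The number `(t + u √D) / 2`. -/
noncomputable def pellUnit (D t u : ℤ) : ℝ := ((t : ℝ) + (u : ℝ) * √(D : ℝ)) / 2

/-! Let α' be the conjugate root, κ = |α - α'|, ξ = x - αy and η = x - α'y, so that Q = aξη and aκ =
√D. For the integer point (x, m) nearest to the line x = αy one has |ξ| = ‖mα‖ and |η| = κm +
O(|ξ|), so m‖mα‖ is close to |Q(x, m)|/√D. Since |Q| ≥ 1 off the origin, m‖mα‖ is bounded below, and
replacing the term by D^(θ/2)|Q|^(-θ) costs only O(1/m²) (`exists_abs_term_sub_le`).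

It remains to sum |Q|^(-θ) over nearest points. The Pell unit ε gives an automorph U of ℤ²
preserving Q, contracting one linear factor by ε and expanding the other by ε; the primary set P
represents each nonzero orbit of ⟨U, -1⟩ once. The orbit of p ∈ P contributes |Q(p)|^(-θ) times the
number of m ≤ M whose nearest point it meets. The exponent j of U must make |ξ| small while keeping
|η| at most about κM, which confines j to an interval of length (log M - log|Q(p)| + O(1))/log ε.
Hence the count is log M/log ε + O(1 + log|Q(p)|) (`exists_abs_card_meets_sub_le`).

On P both factors have size about √|Q|, so ‖p‖² ≪ |Q(p)|, and comparison with the lattice sum of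
‖p‖^(-2θ) gives convergence for θ > 1, with room for the logarithm. Grouping P by the value of Q
turns the sum into the series of R_Q(n)/|n|^θ. -/

/-! ### Irrationality and the linear factors. -/

theorem IsQuadraticIrrational.irrational {α : ℝ} (h : IsQuadraticIrrational α) :
    Irrational α := by
  obtain ⟨p, hp, hdeg, hroot⟩ := h
  rintro ⟨r, rfl⟩
  -- By Gauss's lemma `p` stays irreducible over ℚ, so a rational root would force degree one.
  have hprim : p.IsPrimitive := hp.isPrimitive (by omega)
  have hirr := (Polynomial.IsPrimitive.Int.irreducible_iff_irreducible_map_cast hprim).1 hp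
  have hr : (p.map (Int.castRingHom ℚ)).IsRoot r := by
    rw [Polynomial.IsRoot, Polynomial.eval_map]
    have h2 : ((Polynomial.aeval r p : ℚ) : ℝ) = 0 := by
      rw [← hroot]
      exact (Polynomial.aeval_algebraMap_apply ℝ r p).symm
    exact_mod_cast h2
  have h1 := Polynomial.degree_eq_one_of_irreducible_of_root hirr hr
  rw [Polynomial.degree_map_eq_of_injective (RingHom.injective_int _)] at h1
  have := Polynomial.natDegree_eq_of_degree_eq_some (n := 1) h1
  omega

/-- The linear form `x - α y` on `ℤ ^ 2`. -/
def linForm (α : ℝ) (p : ℤ × ℤ) : ℝ := p.1 - α * p.2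

theorem linForm_neg (α : ℝ) (p : ℤ × ℤ) : linForm α (-p) = -linForm α p := by
  simp [linForm]; ring

theorem linForm_ne_zero {α : ℝ} (hα : Irrational α) {p : ℤ × ℤ} (hp : p ≠ 0) :
    linForm α p ≠ 0 := by
  intro h
  rw [linForm, sub_eq_zero] at h
  by_cases h2 : p.2 = 0
  · apply hp
    rw [h2] at h
    ext
    · simpa using h
    · exact h2
  · have : Irrational (α * p.2) := hα.mul_intCast h2
    exact this ⟨p.1, by push_cast; exact h⟩

/-! ### The form, its roots and its automorphs. -/

namespace IntBinaryForm

theorem four_a_mul_root (Q : IntBinaryForm) {α : ℝ}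
    (hroot : (Q.a : ℝ) * α ^ 2 + (Q.b : ℝ) * α + (Q.c : ℝ) = 0) :
    (2 * Q.a * α + Q.b) ^ 2 = (Q.disc : ℝ) := by
  simp only [disc]
  push_cast
  linear_combination 4 * (Q.a : ℝ) * hroot

theorem disc_pos (Q : IntBinaryForm) {α : ℝ} (hα : Irrational α) (ha : 0 < Q.a)
    (hroot : (Q.a : ℝ) * α ^ 2 + (Q.b : ℝ) * α + (Q.c : ℝ) = 0) : 0 < Q.disc := by
  have h := Q.four_a_mul_root hroot
  have h1 : (2 * Q.a * α + Q.b : ℝ) ≠ 0 := by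
    have : Irrational (2 * Q.a * α + Q.b : ℝ) := by
      have := (hα.intCast_mul (m := 2 * Q.a) (by omega)).add_intCast Q.b
      push_cast at this
      exact this
    exact this.ne_zero
  have : (0 : ℝ) < Q.disc := by rw [← h]; positivity
  exact_mod_cast this

theorem irrational_sqrt_disc (Q : IntBinaryForm) {α : ℝ} (hα : Irrational α) (ha : 0 < Q.a)
    (hroot : (Q.a : ℝ) * α ^ 2 + (Q.b : ℝ) * α + (Q.c : ℝ) = 0) :
    Irrational √(Q.disc : ℝ) := by
  have h := Q.four_a_mul_root hroot
  have h1 : Irrational (2 * Q.a * α + Q.b : ℝ) := by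
    have := (hα.intCast_mul (m := 2 * Q.a) (by omega)).add_intCast Q.b
    push_cast at this
    exact this
  rw [← h, Real.sqrt_sq_eq_abs]
  rcases abs_choice (2 * Q.a * α + Q.b : ℝ) with h | h <;> rw [h]
  · exact h1
  · exact h1.neg

/-- The root `(-b + √D) / (2a)` of the form. -/
noncomputable def rootPos (Q : IntBinaryForm) : ℝ := (-Q.b + √(Q.disc : ℝ)) / (2 * Q.a)

/-- The root `(-b - √D) / (2a)` of the form. -/
noncomputable def rootNeg (Q : IntBinaryForm) : ℝ := (-Q.b - √(Q.disc : ℝ)) / (2 * Q.a)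

theorem root_eq (Q : IntBinaryForm) {α : ℝ} (ha : 0 < Q.a)
    (hroot : (Q.a : ℝ) * α ^ 2 + (Q.b : ℝ) * α + (Q.c : ℝ) = 0) :
    α = Q.rootPos ∨ α = Q.rootNeg := by
  have h := Q.four_a_mul_root hroot
  have ha' : (0 : ℝ) < Q.a := by exact_mod_cast ha
  rw [rootPos, rootNeg, ← h, Real.sqrt_sq_eq_abs]
  rcases abs_choice (2 * Q.a * α + Q.b : ℝ) with h | h <;> rw [h]
  · left; field_simp; ring
  · right; field_simp; ring

theorem irrational_rootPos (Q : IntBinaryForm) (ha : 0 < Q.a) (h : Irrational √(Q.disc : ℝ)) :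
    Irrational Q.rootPos := by
  have := (h.intCast_add (-Q.b)).div_intCast (m := 2 * Q.a) (by omega)
  push_cast at this
  exact this

theorem irrational_rootNeg (Q : IntBinaryForm) (ha : 0 < Q.a) (h : Irrational √(Q.disc : ℝ)) :
    Irrational Q.rootNeg := by
  have := (h.intCast_sub (-Q.b)).div_intCast (m := 2 * Q.a) (by omega)
  push_cast at this
  exact this

theorem rootPos_sub_rootNeg (Q : IntBinaryForm) (ha : 0 < Q.a) :
    Q.a * (Q.rootPos - Q.rootNeg) = √(Q.disc : ℝ) := by
  have ha' : (0 : ℝ) < Q.a := by exact_mod_cast ha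
  rw [rootPos, rootNeg]
  field_simp
  ring

theorem eval_eq (Q : IntBinaryForm) (ha : 0 < Q.a) (hD : 0 < Q.disc) (p : ℤ × ℤ) :
    (Q.eval p.1 p.2 : ℝ) = Q.a * linForm Q.rootPos p * linForm Q.rootNeg p := by
  have ha' : (0 : ℝ) < Q.a := by exact_mod_cast ha
  have hs : √(Q.disc : ℝ) ^ 2 = Q.b ^ 2 - 4 * Q.a * Q.c := by
    rw [Real.sq_sqrt (by exact_mod_cast hD.le), disc]; push_cast; ring
  simp only [eval, linForm, rootPos, rootNeg]
  push_cast
  field_simp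
  linear_combination (p.2 : ℝ) ^ 2 * hs

/-- The signs cross: the factor with `b - √D` is the one that vanishes at `rootPos`. -/
theorem linForm_rootPos (Q : IntBinaryForm) (ha : 0 < Q.a) (p : ℤ × ℤ) :
    2 * (Q.a : ℝ) * p.1 + ((Q.b : ℝ) - √(Q.disc : ℝ)) * p.2 =
      2 * Q.a * linForm Q.rootPos p := by
  have ha' : (0 : ℝ) < Q.a := by exact_mod_cast ha
  simp only [linForm, rootPos]
  field_simp
  ring

theorem linForm_rootNeg (Q : IntBinaryForm) (ha : 0 < Q.a) (p : ℤ × ℤ) :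
    2 * (Q.a : ℝ) * p.1 + ((Q.b : ℝ) + √(Q.disc : ℝ)) * p.2 =
      2 * Q.a * linForm Q.rootNeg p := by
  have ha' : (0 : ℝ) < Q.a := by exact_mod_cast ha
  simp only [linForm, rootNeg]
  field_simp
  ring

theorem mem_primarySet_iff (Q : IntBinaryForm) (ha : 0 < Q.a) {ε : ℝ} (p : ℤ × ℤ) :
    p ∈ Q.primarySet ε ↔ 0 < linForm Q.rootPos p ∧
      |linForm Q.rootPos p| ≤ |linForm Q.rootNeg p| ∧
      |linForm Q.rootNeg p| < ε ^ 2 * |linForm Q.rootPos p| := by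
  have ha' : (0 : ℝ) < Q.a := by exact_mod_cast ha
  simp only [primarySet, Set.mem_ofPred_eq, Q.linForm_rootPos ha, Q.linForm_rootNeg ha]
  rw [mul_pos_iff_of_pos_left (by positivity), mul_div_mul_left _ _ (by positivity), abs_div]
  refine and_congr_right fun h => ?_
  have h' := abs_pos_of_pos h
  rw [one_le_div h', div_lt_iff₀ h']

/-- A solution of Pell's equation gives an automorphism of `ℤ ^ 2` that scales the two linear
factors of the form by the associated unit and its inverse. -/
theorem exists_automorph (Q : IntBinaryForm) (ha : 0 < Q.a) (hD : 0 < Q.disc) {t u : ℤ}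
    (h : t ^ 2 - Q.disc * u ^ 2 = 4) :
    ∃ U : (ℤ × ℤ) ≃+ (ℤ × ℤ),
      (∀ p, linForm Q.rootPos (U p) = (pellUnit Q.disc t u)⁻¹ * linForm Q.rootPos p) ∧
      ∀ p, linForm Q.rootNeg (U p) = pellUnit Q.disc t u * linForm Q.rootNeg p := by
  have ha' : (0 : ℝ) < Q.a := by exact_mod_cast ha
  -- Integrality of the automorph with rows ((t - bu)/2, -cu) and (au, (t + bu)/2): t - bu and t +
  -- bu have the same parity, and their product 4 - 4acu² is even.
  obtain ⟨v, hv⟩ : ∃ v, t = 2 * v + Q.b * u := by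
    have h2 : Even (t - Q.b * u) := by
      have : Even ((t - Q.b * u) * (t + Q.b * u)) := by
        refine ⟨2 - 2 * Q.a * Q.c * u ^ 2, ?_⟩
        rw [disc] at h
        linear_combination h
      rcases Int.even_mul.1 this with h | h
      · exact h
      · rw [show t - Q.b * u = t + Q.b * u - 2 * (Q.b * u) by ring]
        exact h.sub (even_two_mul (Q.b * u))
    obtain ⟨v, hv⟩ := h2
    exact ⟨v, by linarith⟩
  have hdet : v * (v + Q.b * u) + Q.a * Q.c * u ^ 2 = 1 := by
    rw [hv, disc] at h
    linarith
  have hs : √(Q.disc : ℝ) ^ 2 = Q.b ^ 2 - 4 * Q.a * Q.c := by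
    rw [Real.sq_sqrt (by exact_mod_cast hD.le), disc]; push_cast; ring
  have hdet' : (v * (v + Q.b * u) + Q.a * Q.c * u ^ 2 : ℝ) = 1 := by exact_mod_cast hdet
  have hinv : (pellUnit Q.disc t u)⁻¹ = ((t : ℝ) - u * √(Q.disc : ℝ)) / 2 := by
    apply inv_eq_of_mul_eq_one_right
    rw [pellUnit, hv]
    push_cast
    linear_combination hdet' - (u : ℝ) ^ 2 / 4 * hs
  refine ⟨{ toFun := fun p => (v * p.1 - Q.c * u * p.2, Q.a * u * p.1 + (v + Q.b * u) * p.2)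
            invFun := fun p => ((v + Q.b * u) * p.1 + Q.c * u * p.2, -Q.a * u * p.1 + v * p.2)
            left_inv := ?_
            right_inv := ?_
            map_add' := ?_ }, ?_, ?_⟩
  · rintro ⟨x, y⟩
    ext
    · dsimp only; linear_combination x * hdet
    · dsimp only; linear_combination y * hdet
  · rintro ⟨x, y⟩
    ext
    · dsimp only; linear_combination x * hdet
    · dsimp only; linear_combination y * hdet
  · rintro ⟨x, y⟩ ⟨z, w⟩
    ext <;> simp <;> ring
  · rintro ⟨x, y⟩
    rw [hinv, hv]
    simp only [linForm, rootPos, AddEquiv.coe_mk, Equiv.coe_fn_mk]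
    push_cast
    field_simp
    linear_combination (-(u : ℝ) * y ) * hs
  · rintro ⟨x, y⟩
    rw [pellUnit, hv]
    simp only [linForm, rootNeg, AddEquiv.coe_mk, Equiv.coe_fn_mk]
    push_cast
    field_simp
    linear_combination (-(u : ℝ) * y ) * hs

end IntBinaryForm

/-! ### Pell's equation t² - Du² = 4. -/

theorem exists_isSmallestPellSolution {D : ℤ} (hD : 0 < D) (h : Irrational √(D : ℝ)) :
    ∃ t u : ℤ, IsSmallestPellSolution D t u := by
  have hsq : ¬ IsSquare D := by
    rintro ⟨r, rfl⟩
    refine h ⟨|r|, ?_⟩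
    push_cast
    rw [Real.sqrt_mul_self_eq_abs]
  obtain ⟨x, y, hxy, hy⟩ := Pell.exists_of_not_isSquare hD hsq
  have hx : x ≠ 0 := by rintro rfl; nlinarith [sq_nonneg y]
  -- Doubling a solution of x² - Dy² = 1 gives one with right side 4. Minimising u alone suffices,
  -- because t² = Du² + 4 increases with u.
  have hex : ∃ n : ℕ, 0 < n ∧ ∃ t : ℤ, 0 < t ∧ t ^ 2 - D * (n : ℤ) ^ 2 = 4 := by
    refine ⟨(2 * y).natAbs, by omega, |2 * x|, by positivity, ?_⟩
    rw [Int.natCast_natAbs, sq_abs, sq_abs]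
    linear_combination 4 * hxy
  classical
  obtain ⟨hn, t, ht, h4⟩ := Nat.find_spec hex
  refine ⟨t, Nat.find hex, ⟨ht, by exact_mod_cast hn, h4⟩, fun t' u' ht' hu' h' => ?_⟩
  have hu : (Nat.find hex : ℤ) ≤ u' := by
    have := Nat.find_min' hex (m := u'.toNat) ⟨by omega, t', ht', by
      rw [Int.toNat_of_nonneg hu'.le]; exact h'⟩
    omega
  refine ⟨?_, hu⟩
  have hu2 : (Nat.find hex : ℤ) ^ 2 ≤ u' ^ 2 := by gcongr
  have : D * (Nat.find hex : ℤ) ^ 2 ≤ D * u' ^ 2 := by gcongr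
  exact abs_le_of_sq_le_sq' (by linarith) ht'.le |>.2

theorem one_lt_pellUnit {D t u : ℤ} (hD : 0 < D) (h : IsSmallestPellSolution D t u) :
    1 < pellUnit D t u := by
  obtain ⟨⟨ht, hu, h⟩, -⟩ := h
  have h1 : (2 : ℤ) < t := by nlinarith [mul_pos hD (pow_pos hu 2)]
  have h1' : (2 : ℝ) < t := by exact_mod_cast h1
  have hu' : (0 : ℝ) < u := by exact_mod_cast hu
  have : 0 ≤ (u : ℝ) * √(D : ℝ) := by positivity
  rw [pellUnit]
  linarith

/-! ### Orbits of the automorph and primary points. -/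

theorem linForm_zpow {γ c : ℝ} (hc : c ≠ 0) {U : AddAut (ℤ × ℤ)}
    (hU : ∀ p, linForm γ (U p) = c * linForm γ p) (j : ℤ) (p : ℤ × ℤ) :
    linForm γ ((j • U) p) = c ^ j * linForm γ p := by
  induction j generalizing p with
  | zero => simp
  | succ n ih =>
    rw [add_zsmul, one_zsmul, AddAut.add_apply, ih, hU, zpow_add_one₀ hc, mul_assoc]
  | pred n ih =>
    have : ((-(n : ℤ)) • U) p = U (((-(n : ℤ) - 1) • U) p) := by
      conv_rhs => rw [← AddAut.add_apply, ← one_zsmul U, ← mul_zsmul, mul_one, ← add_zsmul]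
      congr 2; ring
    have h2 := ih p
    rw [this, hU] at h2
    rw [zpow_sub_one₀ hc, mul_right_comm, ← h2]
    field_simp

/-- `P` contains exactly one point of each nonzero orbit of the group generated by `U` and `-1`. -/
structure IsFundamentalSet (U : AddAut (ℤ × ℤ)) (P : Set (ℤ × ℤ)) : Prop where
  exists_rep : ∀ q : ℤ × ℤ, q ≠ 0 → ∃ p ∈ P, ∃ j : ℤ, (j • U) p = q ∨ (j • U) p = -q
  unique_rep : ∀ p ∈ P, ∀ p' ∈ P, ∀ j : ℤ, (j • U) p = p' ∨ (j • U) p = -p' → p = p'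

/-- Used when α is `rootNeg`: the factor of α must be contracted, so `U` is replaced by its inverse.
-/
theorem IsFundamentalSet.inv {U : AddAut (ℤ × ℤ)} {P : Set (ℤ × ℤ)}
    (h : IsFundamentalSet U P) : IsFundamentalSet (-U) P where
  exists_rep q hq := by
    obtain ⟨p, hp, j, hj⟩ := h.exists_rep q hq
    exact ⟨p, hp, -j, by simpa using hj⟩
  unique_rep p hp p' hp' j hj := h.unique_rep p hp p' hp' (-j) (by simpa using hj)

/-- `U` multiplies the ratio |η/ξ| by ε², so each orbit has its ratio in [1, ε²) for exactly one
exponent; the condition ξ > 0 then chooses between a point and its negative. -/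
theorem IntBinaryForm.isFundamentalSet_primarySet (Q : IntBinaryForm) (ha : 0 < Q.a)
    (hs : Irrational √(Q.disc : ℝ)) {ε : ℝ} (hε : 1 < ε) {U : AddAut (ℤ × ℤ)}
    (hU : ∀ p, linForm Q.rootPos (U p) = ε⁻¹ * linForm Q.rootPos p)
    (hU' : ∀ p, linForm Q.rootNeg (U p) = ε * linForm Q.rootNeg p) :
    IsFundamentalSet U (Q.primarySet ε) := by
  have hε0 : 0 < ε := by linarith
  have hβ := Q.irrational_rootPos ha hs
  have hβ' := Q.irrational_rootNeg ha hs
  have hε2 : 1 < ε ^ 2 := one_lt_pow₀ hε two_ne_zero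
  have hz := linForm_zpow (by positivity) hU
  have hz' := linForm_zpow (by positivity) hU'
  constructor
  · intro q hq
    have h1 := abs_pos.2 (linForm_ne_zero hβ hq)
    have h2 := abs_pos.2 (linForm_ne_zero hβ' hq)
    obtain ⟨j, hj1, hj2⟩ := exists_mem_Ico_zpow (div_pos h2 h1) hε2
    rw [le_div_iff₀ h1] at hj1
    rw [div_lt_iff₀ h1] at hj2
    have hpos := zpow_pos hε0 j
    set p := ((-j) • U) q with hp
    have hUp : (j • U) p = q := by
      rw [hp, ← AddAut.add_apply, ← add_zsmul, add_neg_cancel, zero_zsmul, AddAut.zero_apply]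
    have hp1 : |linForm Q.rootPos p| = ε ^ j * |linForm Q.rootPos q| := by
      rw [hp, hz, abs_mul, abs_of_pos (by positivity), inv_zpow', neg_neg]
    have hp2 : |linForm Q.rootNeg q| = ε ^ j * |linForm Q.rootNeg p| := by
      rw [← hUp, hz', abs_mul, abs_of_pos hpos]
    have hsq : (ε ^ 2) ^ j = ε ^ j * ε ^ j := by rw [sq, mul_zpow]
    have hle : |linForm Q.rootPos p| ≤ |linForm Q.rootNeg p| := by
      rw [hp2, hsq, mul_assoc] at hj1
      rw [hp1]
      exact le_of_mul_le_mul_left hj1 hpos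
    have hlt : |linForm Q.rootNeg p| < ε ^ 2 * |linForm Q.rootPos p| := by
      rw [hp2, zpow_add_one₀ (by positivity), hsq] at hj2
      rw [hp1]
      refine lt_of_mul_lt_mul_left (a := ε ^ j) ?_ hpos.le
      linarith
    have hp0 : linForm Q.rootPos p ≠ 0 := by
      rw [← abs_pos, hp1]; positivity
    rcases hp0.lt_or_gt with h | h
    · refine ⟨-p, (Q.mem_primarySet_iff ha _).2 ?_, j, Or.inr (by rw [map_neg, hUp])⟩
      simp only [linForm_neg, abs_neg]
      exact ⟨by linarith, hle, hlt⟩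
    · exact ⟨p, (Q.mem_primarySet_iff ha _).2 ⟨h, hle, hlt⟩, j, Or.inl hUp⟩
  · intro p hp p' hp' j hj
    rw [Q.mem_primarySet_iff ha] at hp hp'
    have hpos := zpow_pos hε0 j
    have h1 : ε ^ j * |linForm Q.rootPos p'| = |linForm Q.rootPos p| := by
      have : |linForm Q.rootPos ((j • U) p)| = |linForm Q.rootPos p'| := by
        rcases hj with h | h <;> simp [h, linForm_neg]
      rw [← this, hz, abs_mul, abs_of_pos (by positivity), inv_zpow, mul_inv_cancel_left₀ hpos.ne']
    have h2 : |linForm Q.rootNeg p'| = ε ^ j * |linForm Q.rootNeg p| := by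
      have : |linForm Q.rootNeg ((j • U) p)| = |linForm Q.rootNeg p'| := by
        rcases hj with h | h <;> simp [h, linForm_neg]
      rw [← this, hz', abs_mul, abs_of_pos hpos]
    obtain ⟨ha1, ha2, ha3⟩ := hp
    obtain ⟨hb1, hb2, hb3⟩ := hp'
    have hξ' := abs_pos_of_pos hb1
    -- The two ratios differ by the factor ε^(2j) and both lie in [1, ε²).
    have hj0 : j = 0 := by
      rcases lt_trichotomy j 0 with hlt | h0 | hgt
      · have hle : ε ^ j ≤ ε⁻¹ := by
          rw [← zpow_neg_one]
          exact zpow_le_zpow_right₀ hε.le (by omega)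
        have hle' : ε ^ j * ε ≤ 1 := by
          rw [← inv_mul_cancel₀ hε0.ne']; gcongr
        have h3 : ε ^ j * |linForm Q.rootNeg p| < ε ^ j * (ε ^ 2 * |linForm Q.rootPos p|) := by
          gcongr
        rw [← h2, ← h1] at h3
        have h4 : ε ^ j * (ε ^ 2 * (ε ^ j * |linForm Q.rootPos p'|)) =
          (ε ^ j * ε) ^ 2 * |linForm Q.rootPos p'| := by ring
        have h5 : (ε ^ j * ε) ^ 2 ≤ 1 := pow_le_one₀ (by positivity) hle'
        nlinarith
      · exact h0
      · have hle : ε ≤ ε ^ j := by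
          conv_lhs => rw [← zpow_one ε]
          exact zpow_le_zpow_right₀ hε.le (by omega)
        have h3 : ε ^ j * |linForm Q.rootPos p| ≤ ε ^ j * |linForm Q.rootNeg p| := by gcongr
        rw [← h2, ← h1] at h3
        have h5 : ε ^ 2 ≤ (ε ^ j) ^ 2 := by gcongr
        nlinarith
    rw [hj0, zero_zsmul, AddAut.zero_apply] at hj
    rcases hj with h | h
    · exact h
    · rw [h, linForm_neg] at ha1
      linarith

/-! ### Hyperbolic data and convergence over representatives. -/

/-- The data used to count lattice points near the line `x = α y`: a form with linear factors
`x - α y` and `x - α' y`, an automorphism `U` contracting the first and expanding the second, and a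
set `P` of orbit representatives on which both factors have comparable size. -/
structure HyperbolicData (Q : IntBinaryForm) (α α' ε : ℝ) (U : AddAut (ℤ × ℤ))
    (P : Set (ℤ × ℤ)) : Prop where
  a_pos : 0 < Q.a
  irrational : Irrational α
  irrational' : Irrational α'
  ne : α ≠ α'
  eval_eq : ∀ p : ℤ × ℤ, (Q.eval p.1 p.2 : ℝ) = Q.a * linForm α p * linForm α' p
  one_lt : 1 < ε
  contract : ∀ p, linForm α (U p) = ε⁻¹ * linForm α p
  expand : ∀ p, linForm α' (U p) = ε * linForm α' p
  fundamental : IsFundamentalSet U P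
  ne_zero : ∀ p ∈ P, p ≠ 0
  le_mul : ∀ p ∈ P, |linForm α p| ≤ ε ^ 2 * |linForm α' p|
  le_mul' : ∀ p ∈ P, |linForm α' p| ≤ ε ^ 2 * |linForm α p|

theorem summable_norm_rpow_int_prod {k : ℝ} (hk : 2 < k) :
    Summable fun p : ℤ × ℤ => ‖p‖ ^ (-k) := by
  rw [← (finTwoArrowEquiv ℤ).summable_iff]
  refine (EisensteinSeries.summable_one_div_norm_rpow hk).congr fun x => ?_
  have : ‖(finTwoArrowEquiv ℤ) x‖ = ‖x‖ := by
    apply le_antisymm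
    · exact max_le (norm_le_pi_norm x 0) (norm_le_pi_norm x 1)
    · rw [pi_norm_le_iff_of_nonneg (norm_nonneg _)]
      intro i
      fin_cases i
      · exact norm_fst_le ((finTwoArrowEquiv ℤ) x)
      · exact norm_snd_le ((finTwoArrowEquiv ℤ) x)
  simp only [Function.comp_apply, this]

theorem linForm_sub_linForm (α α' : ℝ) (p : ℤ × ℤ) :
    linForm α' p - linForm α p = (α - α') * p.2 := by
  simp only [linForm]; ring

/-- For α ≠ α' the two forms are coordinates: their difference recovers y, and then x = ξ + αy. -/
theorem exists_norm_le_linForm {α α' : ℝ} (h : α ≠ α') :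
    ∃ C, 0 < C ∧ ∀ p : ℤ × ℤ, ‖p‖ ≤ C * (|linForm α p| + |linForm α' p|) := by
  have hκ : 0 < |α - α'| := abs_pos.2 (sub_ne_zero.2 h)
  refine ⟨1 + (|α| + 1) / |α - α'|, by positivity, fun p => ?_⟩
  set s := |linForm α p| + |linForm α' p| with hs
  have hs0 : 0 ≤ s := by positivity
  have hy : |(p.2 : ℝ)| ≤ s / |α - α'| := by
    rw [le_div_iff₀ hκ, ← abs_mul, mul_comm, ← linForm_sub_linForm, hs, add_comm]
    exact abs_sub _ _
  have hx : |(p.1 : ℝ)| ≤ s + |α| * (s / |α - α'|) := by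
    have : (p.1 : ℝ) = linForm α p + α * p.2 := by simp [linForm]
    rw [this]
    refine (abs_add_le _ _).trans ?_
    rw [abs_mul]
    gcongr
    rw [hs]
    exact le_add_of_nonneg_right (abs_nonneg _)
  have e : (1 + (|α| + 1) / |α - α'|) * s =
      s + |α| * (s / |α - α'|) + s / |α - α'| := by field_simp; ring
  rw [Prod.norm_def, Int.norm_eq_abs, Int.norm_eq_abs, e]
  refine max_le ?_ ?_
  · have : 0 ≤ s / |α - α'| := by positivity
    linarith
  · have : 0 ≤ |α| * (s / |α - α'|) := by positivity
    linarith

namespace HyperbolicData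

variable {Q : IntBinaryForm} {α α' ε : ℝ} {U : AddAut (ℤ × ℤ)} {P : Set (ℤ × ℤ)}

theorem abs_eval_eq (h : HyperbolicData Q α α' ε U P) (p : ℤ × ℤ) :
    |(Q.eval p.1 p.2 : ℝ)| = Q.a * |linForm α p| * |linForm α' p| := by
  have ha : (0 : ℝ) < Q.a := by exact_mod_cast h.a_pos
  rw [h.eval_eq, abs_mul, abs_mul, abs_of_pos ha]

theorem eval_ne_zero (h : HyperbolicData Q α α' ε U P) {p : ℤ × ℤ} (hp : p ≠ 0) :
    Q.eval p.1 p.2 ≠ 0 := by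
  have ha : (0 : ℝ) < Q.a := by exact_mod_cast h.a_pos
  have := mul_ne_zero (mul_ne_zero ha.ne' (linForm_ne_zero h.irrational hp))
    (linForm_ne_zero h.irrational' hp)
  rw [← h.eval_eq] at this
  exact_mod_cast this

theorem one_le_abs_eval (h : HyperbolicData Q α α' ε U P) {p : ℤ × ℤ} (hp : p ≠ 0) :
    1 ≤ |(Q.eval p.1 p.2 : ℝ)| := by
  exact_mod_cast Int.one_le_abs (h.eval_ne_zero hp)

/-- On `P` each of |ξ|, |η| bounds the other up to ε², so ‖p‖ is bounded by a multiple of either;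
multiplying the two bounds produces |ξη|. -/
theorem exists_norm_sq_le (h : HyperbolicData Q α α' ε U P) :
    ∃ C, 0 < C ∧ ∀ p ∈ P, ‖p‖ ^ 2 ≤ C * |(Q.eval p.1 p.2 : ℝ)| := by
  have ha : (1 : ℝ) ≤ Q.a := by exact_mod_cast h.a_pos
  obtain ⟨C, hC, hb⟩ := exists_norm_le_linForm h.ne
  refine ⟨(C * (1 + ε ^ 2)) ^ 2, by positivity, fun p hp => ?_⟩
  have h1 := h.le_mul p hp
  have h2 := h.le_mul' p hp
  have b1 : ‖p‖ ≤ C * (1 + ε ^ 2) * |linForm α p| := by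
    calc ‖p‖ ≤ C * (|linForm α p| + |linForm α' p|) := hb p
      _ ≤ C * (|linForm α p| + ε ^ 2 * |linForm α p|) := by gcongr
      _ = _ := by ring
  have b2 : ‖p‖ ≤ C * (1 + ε ^ 2) * |linForm α' p| := by
    calc ‖p‖ ≤ C * (|linForm α p| + |linForm α' p|) := hb p
      _ ≤ C * (ε ^ 2 * |linForm α' p| + |linForm α' p|) := by gcongr
      _ = _ := by ring
  calc ‖p‖ ^ 2 = ‖p‖ * ‖p‖ := sq _
    _ ≤ (C * (1 + ε ^ 2) * |linForm α p|) * (C * (1 + ε ^ 2) * |linForm α' p|) := by gcongr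
    _ = (C * (1 + ε ^ 2)) ^ 2 * (1 * |linForm α p| * |linForm α' p|) := by ring
    _ ≤ (C * (1 + ε ^ 2)) ^ 2 * |(Q.eval p.1 p.2 : ℝ)| := by
      rw [h.abs_eval_eq]; gcongr

theorem finite_reps (h : HyperbolicData Q α α' ε U P) (n : ℤ) :
    ({p : ℤ × ℤ | Q.eval p.1 p.2 = n} ∩ P).Finite := by
  obtain ⟨C, hC, hb⟩ := h.exists_norm_sq_le
  refine (Metric.finite_isBounded_inter_isClosed (K := Metric.closedBall 0 √(C * |(n : ℝ)|))
    (s := Set.univ) DiscreteTopology.isDiscrete Metric.isBounded_closedBall isClosed_univ).subset ?_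
  rintro p ⟨hp1, hp2⟩
  refine ⟨?_, trivial⟩
  rw [mem_closedBall_zero_iff]
  apply Real.le_sqrt_of_sq_le
  have := hb p hp2
  rw [Set.mem_ofPred_eq] at hp1
  rwa [hp1] at this

theorem summable_rpow (h : HyperbolicData Q α α' ε U P) {θ : ℝ} (hθ : 1 < θ) :
    Summable fun p : P => |(Q.eval p.1.1 p.1.2 : ℝ)| ^ (-θ) := by
  obtain ⟨C, hC, hb⟩ := h.exists_norm_sq_le
  have hs := ((summable_norm_rpow_int_prod (k := 2 * θ) (by linarith)).mul_left (C ^ θ)).subtype P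
  refine hs.of_nonneg_of_le (fun p => by positivity) fun p => ?_
  have hp := norm_pos_iff.2 (h.ne_zero p p.2)
  have h1 : ‖(p : ℤ × ℤ)‖ ^ 2 / C ≤ |(Q.eval p.1.1 p.1.2 : ℝ)| := by
    rw [div_le_iff₀ hC, mul_comm]
    exact hb p p.2
  refine (Real.rpow_le_rpow_of_nonpos (by positivity) h1 (by linarith)).trans (le_of_eq ?_)
  rw [Real.div_rpow (by positivity) hC.le, ← Real.rpow_natCast, ← Real.rpow_mul hp.le,
    Real.rpow_neg hC.le, div_inv_eq_mul, mul_comm]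
  simp only [Function.comp_apply]
  congr 2
  push_cast
  ring

/-- The logarithm is absorbed by a power |Q|^δ, with δ small enough that θ - δ still exceeds 1. -/
theorem summable_rpow_mul_log (h : HyperbolicData Q α α' ε U P) {θ : ℝ} (hθ : 1 < θ) :
    Summable fun p : P => |(Q.eval p.1.1 p.1.2 : ℝ)| ^ (-θ) *
      (1 + Real.log |(Q.eval p.1.1 p.1.2 : ℝ)|) := by
  set δ := (θ - 1) / 2 with hδ
  have hδ0 : 0 < δ := by rw [hδ]; linarith
  refine ((h.summable_rpow (θ := θ - δ) (by rw [hδ]; linarith)).mul_left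
    (1 + 1 / δ)).of_nonneg_of_le (fun p => ?_) fun p => ?_
  · have := Real.log_nonneg (h.one_le_abs_eval (h.ne_zero p p.2))
    positivity
  · have h1 := h.one_le_abs_eval (h.ne_zero p p.2)
    set n := |(Q.eval p.1.1 p.1.2 : ℝ)|
    have h2 := Real.log_le_rpow_div (x := n) (by linarith) hδ0
    have h3 := Real.one_le_rpow h1 hδ0.le
    calc n ^ (-θ) * (1 + Real.log n) ≤ n ^ (-θ) * (n ^ δ + n ^ δ / δ) := by gcongr
      _ = (1 + 1 / δ) * (n ^ (-θ) * n ^ δ) := by ring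
      _ = (1 + 1 / δ) * n ^ (-(θ - δ)) := by
        rw [← Real.rpow_add (by linarith)]; congr 2; ring

end HyperbolicData

/-! ### Counting the nearest points met by an orbit. -/

/-- The lattice point on the line `y = m` nearest to the line `x = α y`. -/
noncomputable def nearPoint (α : ℝ) (m : ℕ) : ℤ × ℤ := (round ((m : ℝ) * α), (m : ℤ))

theorem abs_linForm_nearPoint (α : ℝ) (m : ℕ) :
    |linForm α (nearPoint α m)| = distNearestInt (m * α) := by
  rw [distNearestInt, abs_sub_comm]
  simp [linForm, nearPoint, mul_comm]

theorem nearPoint_ne_zero (α : ℝ) {m : ℕ} (hm : 1 ≤ m) : nearPoint α m ≠ 0 := by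
  intro h
  have := congrArg Prod.snd h
  simp only [nearPoint, Prod.snd_zero, Nat.cast_eq_zero] at this
  omega

theorem eq_nearPoint {α : ℝ} {p : ℤ × ℤ} {m : ℕ} (hm : p.2 = m) (h : |linForm α p| < 1 / 2) :
    p = nearPoint α m := by
  have h1 := abs_sub_round ((m : ℝ) * α)
  have h2 : |(p.1 : ℝ) - (round ((m : ℝ) * α) : ℝ)| < 1 := by
    have e : (p.1 : ℝ) - (round ((m : ℝ) * α) : ℝ) =
        linForm α p + (m * α - (round ((m : ℝ) * α) : ℝ)) := by
      simp only [linForm, hm, Int.cast_natCast]; ring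
    rw [e]
    exact (abs_add_le _ _).trans_lt (by linarith)
  have h3 : |p.1 - round ((m : ℝ) * α)| < 1 := by exact_mod_cast h2
  ext
  · exact sub_eq_zero.1 (Int.abs_lt_one_iff.1 h3)
  · exact hm

theorem Int.card_Icc_ceil_floor_le {A B L : ℝ} (hL : 0 ≤ L) (h : B - A ≤ L) :
    ((Finset.Icc ⌈A⌉ ⌊B⌋).card : ℝ) ≤ L + 1 := by
  rw [Int.card_Icc]
  rcases le_total 0 (⌊B⌋ + 1 - ⌈A⌉) with h0 | h0
  · have : (((⌊B⌋ + 1 - ⌈A⌉).toNat : ℤ) : ℝ) = (⌊B⌋ : ℝ) + 1 - ⌈A⌉ := by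
      rw [Int.toNat_of_nonneg h0]; push_cast; ring
    rw [Int.cast_natCast] at this
    rw [this]
    linarith [Int.floor_le B, Int.le_ceil A]
  · rw [Int.toNat_of_nonpos h0]
    simp only [Nat.cast_zero]
    linarith

theorem Int.le_card_Icc_ceil_floor (A B : ℝ) :
    B - A - 1 ≤ ((Finset.Icc ⌈A⌉ ⌊B⌋).card : ℝ) := by
  rw [Int.card_Icc]
  have h0 : ((⌊B⌋ + 1 - ⌈A⌉ : ℤ) : ℝ) ≤ (((⌊B⌋ + 1 - ⌈A⌉).toNat : ℤ) : ℝ) := by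
    exact_mod_cast Int.self_le_toNat _
  push_cast at h0
  linarith [Int.lt_floor_add_one B, Int.ceil_lt_add_one A]

namespace HyperbolicData

variable {Q : IntBinaryForm} {α α' ε : ℝ} {U : AddAut (ℤ × ℤ)} {P : Set (ℤ × ℤ)}

theorem log_linForm_zsmul (h : HyperbolicData Q α α' ε U P) {p : ℤ × ℤ} (hp : p ≠ 0) (j : ℤ) :
    Real.log |linForm α ((j • U) p)| = Real.log |linForm α p| - j * Real.log ε := by
  have hε : 0 < ε := by linarith [h.one_lt]
  have := abs_pos.2 (linForm_ne_zero h.irrational hp)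
  rw [linForm_zpow (by positivity) h.contract, abs_mul, abs_of_pos (by positivity),
    Real.log_mul (by positivity) this.ne', Real.log_zpow, Real.log_inv]
  ring

theorem log_linForm_zsmul' (h : HyperbolicData Q α α' ε U P) {p : ℤ × ℤ} (hp : p ≠ 0) (j : ℤ) :
    Real.log |linForm α' ((j • U) p)| = Real.log |linForm α' p| + j * Real.log ε := by
  have hε : 0 < ε := by linarith [h.one_lt]
  have := abs_pos.2 (linForm_ne_zero h.irrational' hp)
  rw [linForm_zpow (by positivity) h.expand, abs_mul, abs_of_pos (by positivity),
    Real.log_mul (by positivity) this.ne', Real.log_zpow]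
  ring

theorem abs_linForm_nearPoint_le (α α' : ℝ) {m : ℕ} :
    |linForm α' (nearPoint α m)| ≤ 1 / 2 + m * |α - α'| := by
  have h1 := linForm_sub_linForm α α' (nearPoint α m)
  have h2 : |linForm α (nearPoint α m)| ≤ 1 / 2 := by
    rw [abs_linForm_nearPoint]; exact abs_sub_round _
  have h3 : linForm α' (nearPoint α m) =
      linForm α (nearPoint α m) + (α - α') * m := by
    rw [← sub_eq_iff_eq_add', h1]; simp [nearPoint]
  rw [h3]
  refine (abs_add_le _ _).trans ?_
  rw [abs_mul, Nat.abs_cast, mul_comm]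
  gcongr

/-- Up to sign, `nearPoint α m` lies in the orbit of `p`. -/
def Meets (α : ℝ) (U : AddAut (ℤ × ℤ)) (p : ℤ × ℤ) (m : ℕ) : Prop :=
  ∃ j : ℤ, (j • U) p = nearPoint α m ∨ (j • U) p = -nearPoint α m

open Classical in
-- At a nearest point with m ≤ M, |ξ| ≤ 1 bounds j below and |η| ≤ (1/2 + κ)M bounds it above. Since
-- |Q(p)| ≥ 1 gives -X - Y ≤ log a, the interval length is bounded uniformly in p.
theorem exists_card_meets_le (h : HyperbolicData Q α α' ε U P) :
    ∃ C, ∀ p ∈ P, ∀ M : ℕ, 1 ≤ M →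
      (((Finset.Icc 1 M).filter (Meets α U p)).card : ℝ) ≤ Real.log M / Real.log ε + C := by
  have ha : (1 : ℝ) ≤ Q.a := by exact_mod_cast h.a_pos
  have hlam : 0 < Real.log ε := Real.log_pos h.one_lt
  set lam := Real.log ε
  set κ := |α - α'| with hκ
  have hκ0 : 0 < κ := abs_pos.2 (sub_ne_zero.2 h.ne)
  set K := Real.log (1 / 2 + κ)
  refine ⟨(|K| + Real.log Q.a) / lam + 1, fun p hp M hM => ?_⟩
  have hp0 := h.ne_zero p hp
  have hM' : (1 : ℝ) ≤ M := by exact_mod_cast hM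
  have hξ := abs_pos.2 (linForm_ne_zero h.irrational hp0)
  have hη := abs_pos.2 (linForm_ne_zero h.irrational' hp0)
  have hn := Real.log_nonneg (h.one_le_abs_eval hp0)
  rw [h.abs_eval_eq, Real.log_mul (by positivity) hη.ne', Real.log_mul (by positivity) hξ.ne'] at hn
  set X := Real.log |linForm α p|
  set Y := Real.log |linForm α' p|
  have hlogM := Real.log_nonneg hM'
  have hloga := Real.log_nonneg ha
  have key : ∀ m ∈ (Finset.Icc 1 M).filter (Meets α U p), ∃ j ∈
      Finset.Icc ⌈X / lam⌉ ⌊(Real.log M + K - Y) / lam⌋,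
      (j • U) p = nearPoint α m ∨ (j • U) p = -nearPoint α m := by
    intro m hm
    rw [Finset.mem_filter, Finset.mem_Icc] at hm
    obtain ⟨⟨hm1, hm2⟩, j, hj⟩ := hm
    refine ⟨j, ?_, hj⟩
    have hm2' : (m : ℝ) ≤ M := by exact_mod_cast hm2
    have e1 : |linForm α ((j • U) p)| = |linForm α (nearPoint α m)| := by
      rcases hj with hj | hj <;> simp [hj, linForm_neg]
    have e2 : |linForm α' ((j • U) p)| = |linForm α' (nearPoint α m)| := by
      rcases hj with hj | hj <;> simp [hj, linForm_neg]
    have hq := nearPoint_ne_zero α hm1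
    have hq' := abs_pos.2 (linForm_ne_zero h.irrational' hq)
    have l1 := h.log_linForm_zsmul hp0 j
    have l2 := h.log_linForm_zsmul' hp0 j
    rw [e1] at l1
    rw [e2] at l2
    have i1 : Real.log |linForm α (nearPoint α m)| ≤ 0 := by
      apply Real.log_nonpos (abs_nonneg _)
      rw [abs_linForm_nearPoint]
      exact (abs_sub_round _).trans (by norm_num)
    have i2 : Real.log |linForm α' (nearPoint α m)| ≤ Real.log M + K := by
      rw [← Real.log_mul (by positivity) (by positivity)]
      apply Real.log_le_log hq'
      refine (abs_linForm_nearPoint_le α α').trans ?_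
      have : (m : ℝ) * κ ≤ M * κ := by gcongr
      linarith
    rw [Finset.mem_Icc, Int.ceil_le, Int.le_floor, div_le_iff₀ hlam, le_div_iff₀ hlam]
    constructor <;> linarith
  choose! J hJ1 hJ2 using key
  -- The exponent determines the orbit point, whose second coordinate is ±m.
  have hcard := Finset.card_le_card_of_injOn J hJ1 (fun m hm m' hm' hjj => by
    have s1 := hJ2 m hm
    have s2 := hJ2 m' hm'
    rw [hjj] at s1
    have t1 := s1.imp (congrArg Prod.snd) (congrArg Prod.snd)
    have t2 := s2.imp (congrArg Prod.snd) (congrArg Prod.snd)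
    simp only [nearPoint, Prod.snd_neg] at t1 t2
    omega)
  have hcard' : (((Finset.Icc 1 M).filter (Meets α U p)).card : ℝ) ≤
    ((Finset.Icc ⌈X / lam⌉ ⌊(Real.log M + K - Y) / lam⌋).card : ℝ) := by exact_mod_cast hcard
  refine hcard'.trans ((Int.card_Icc_ceil_floor_le
    (L := (Real.log M + |K| + Real.log Q.a) / lam) (by positivity) ?_).trans (le_of_eq ?_))
  · rw [← sub_div]
    gcongr
    linarith [le_abs_self K]
  · ring

open Classical in
-- Conversely, every j in a slightly shorter interval yields a nearest point. The loss log|Q(p)|/log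
-- ε is the term X + Y + log a in the interval length.
theorem exists_le_card_meets (h : HyperbolicData Q α α' ε U P) :
    ∃ C, ∀ p ∈ P, ∀ M : ℕ, 1 ≤ M →
      Real.log M / Real.log ε - C - Real.log |(Q.eval p.1 p.2 : ℝ)| / Real.log ε ≤
        (((Finset.Icc 1 M).filter (Meets α U p)).card : ℝ) := by
  have ha : (1 : ℝ) ≤ Q.a := by exact_mod_cast h.a_pos
  have hε : 0 < ε := by linarith [h.one_lt]
  have hlam : 0 < Real.log ε := Real.log_pos h.one_lt
  set lam := Real.log ε with hlamdef
  set κ := |α - α'| with hκ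
  have hκ0 : 0 < κ := abs_pos.2 (sub_ne_zero.2 h.ne)
  set K := Real.log (κ / 2)
  refine ⟨(1 + Real.log Q.a + 2 * lam + |K|) / lam + 1, fun p hp M hM => ?_⟩
  have hp0 := h.ne_zero p hp
  have hM' : (1 : ℝ) ≤ M := by exact_mod_cast hM
  have hξ := abs_pos.2 (linForm_ne_zero h.irrational hp0)
  have hη := abs_pos.2 (linForm_ne_zero h.irrational' hp0)
  have hn := Real.log_nonneg (h.one_le_abs_eval hp0)
  rw [h.abs_eval_eq, Real.log_mul (by positivity) hη.ne', Real.log_mul (by positivity) hξ.ne']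
    at hn ⊢
  have hXY := Real.log_le_log hξ (h.le_mul p hp)
  have hYX := Real.log_le_log hη (h.le_mul' p hp)
  rw [Real.log_mul (by positivity) (by positivity), Real.log_pow, Nat.cast_ofNat] at hXY hYX
  rw [← hlamdef] at hXY hYX
  set X := Real.log |linForm α p|
  set Y := Real.log |linForm α' p|
  have hloga := Real.log_nonneg ha
  -- The summand 1 exceeds log 2 and forces |ξ| < 1/2; log a, together with |Q(p)| ≥ 1, helps to
  -- give |ξ| ≤ |η|. In `B` the constant κ/2 gives |η| ≤ κM/2, whence κ|y| = |η - ξ| ≤ κM.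
  set A := (X + (1 + Real.log Q.a + 2 * lam)) / lam with hA
  set B := (Real.log M + K - Y) / lam with hB
  have key : ∀ j ∈ Finset.Icc ⌈A⌉ ⌊B⌋, ∃ m ∈ (Finset.Icc 1 M).filter (Meets α U p),
      (j • U) p = nearPoint α m ∨ (j • U) p = -nearPoint α m := by
    intro j hj
    rw [Finset.mem_Icc, Int.ceil_le, Int.le_floor, hA, hB, div_le_iff₀ hlam, le_div_iff₀ hlam] at hj
    obtain ⟨hj1, hj2⟩ := hj
    have l1 := h.log_linForm_zsmul hp0 j
    have l2 := h.log_linForm_zsmul' hp0 j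
    set w := (j • U) p with hw
    have hw0 : w ≠ 0 := by rw [hw]; simpa using hp0
    have hwξ := abs_pos.2 (linForm_ne_zero h.irrational hw0)
    have hwη := abs_pos.2 (linForm_ne_zero h.irrational' hw0)
    have hsmall : |linForm α w| < 1 / 2 := by
      rw [← Real.log_lt_log_iff hwξ (by norm_num), l1, one_div, Real.log_inv]
      linarith [Real.log_two_lt_d9]
    have hle : |linForm α w| ≤ |linForm α' w| := by
      rw [← Real.log_le_log_iff hwξ hwη, l1, l2]
      linarith
    have hM2 : |linForm α' w| ≤ M * (κ / 2) := by
      rw [← Real.log_le_log_iff hwη (by positivity), l2, Real.log_mul (by positivity) (by positivity)]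
      linarith
    have hy : w.2 ≠ 0 := by
      intro h0
      have : linForm α w = w.1 := by simp [linForm, h0]
      rw [this] at hsmall
      have h1 : |(w.1 : ℝ)| < 1 := by linarith
      have h2 : |w.1| < 1 := by exact_mod_cast h1
      exact hw0 (Prod.ext (Int.abs_lt_one_iff.1 h2) h0)
    have hyM : w.2.natAbs ≤ M := by
      have e := linForm_sub_linForm α α' w
      have e2 : κ * |(w.2 : ℝ)| ≤ κ * M := by
        rw [hκ, ← abs_mul, ← e, ← hκ]
        refine (abs_sub _ _).trans ?_
        linarith
      have e3 := le_of_mul_le_mul_left e2 hκ0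
      have e4 : |w.2| ≤ (M : ℤ) := by exact_mod_cast e3
      rw [Int.abs_eq_natAbs] at e4
      omega
    have hnear : w = nearPoint α w.2.natAbs ∨ w = -nearPoint α w.2.natAbs := by
      rcases le_total 0 w.2 with h0 | h0
      · left
        exact eq_nearPoint (by omega) hsmall
      · right
        rw [← neg_eq_iff_eq_neg]
        exact eq_nearPoint (by rw [Prod.snd_neg]; omega) (by rwa [linForm_neg, abs_neg])
    refine ⟨w.2.natAbs, ?_, hnear⟩
    rw [Finset.mem_filter, Finset.mem_Icc]
    exact ⟨⟨by omega, hyM⟩, j, hnear⟩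
  choose! m hm1 hm2 using key
  -- Different exponents give different |ξ|, since ε > 1, so they cannot share the same m.
  have hcard := Finset.card_le_card_of_injOn m hm1 (fun j hj j' hj' hmm => by
    have s1 := hm2 j hj
    have s2 := hm2 j' hj'
    rw [hmm] at s1
    have e1 : |linForm α ((j • U) p)| = |linForm α ((j' • U) p)| := by
      rcases s1 with s1 | s1 <;> rcases s2 with s2 | s2 <;> simp [s1, s2, linForm_neg]
    have e2 := congrArg Real.log e1
    rw [h.log_linForm_zsmul hp0, h.log_linForm_zsmul hp0, sub_right_inj] at e2
    exact_mod_cast mul_right_cancel₀ hlam.ne' e2)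
  have hcard' : ((Finset.Icc ⌈A⌉ ⌊B⌋).card : ℝ) ≤
    (((Finset.Icc 1 M).filter (Meets α U p)).card : ℝ) := by exact_mod_cast hcard
  refine le_trans (le_trans ?_ (Int.le_card_Icc_ceil_floor A B)) hcard'
  rw [hA, hB, ← sub_div, sub_sub, ← sub_sub, tsub_le_iff_right, ← sub_nonneg]
  have : (Real.log M + K - Y - (X + (1 + Real.log Q.a + 2 * lam))) / lam - 1 +
      (Real.log Q.a + X + Y) / lam - (Real.log M / lam -
        ((1 + Real.log Q.a + 2 * lam + |K|) / lam + 1)) = (Real.log Q.a + (K + |K|)) / lam := by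
    field_simp
    ring
  have h2 := neg_abs_le K
  have h3 : 0 ≤ (Real.log Q.a + (K + |K|)) / lam := div_nonneg (by linarith) hlam.le
  linarith

open Classical in
theorem exists_abs_card_meets_sub_le (h : HyperbolicData Q α α' ε U P) :
    ∃ C, ∀ p ∈ P, ∀ M : ℕ, 1 ≤ M →
      |(((Finset.Icc 1 M).filter (Meets α U p)).card : ℝ) - Real.log M / Real.log ε| ≤
        C * (1 + Real.log |(Q.eval p.1 p.2 : ℝ)|) := by
  have hlam : 0 < Real.log ε := Real.log_pos h.one_lt
  obtain ⟨C₁, h₁⟩ := h.exists_card_meets_le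
  obtain ⟨C₂, h₂⟩ := h.exists_le_card_meets
  refine ⟨|C₁| + |C₂| + 1 / Real.log ε, fun p hp M hM => ?_⟩
  have hn := Real.log_nonneg (h.one_le_abs_eval (h.ne_zero p hp))
  specialize h₁ p hp M hM
  specialize h₂ p hp M hM
  set n := Real.log |(Q.eval p.1 p.2 : ℝ)|
  have e : (|C₁| + |C₂| + 1 / Real.log ε) * (1 + n) =
      |C₁| + |C₂| + n / Real.log ε + ((|C₁| + |C₂|) * n + 1 / Real.log ε) := by ring
  have i : 0 ≤ (|C₁| + |C₂|) * n + 1 / Real.log ε := by positivity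
  have i2 : 0 ≤ n / Real.log ε := by positivity
  rw [e, abs_le]
  constructor <;> linarith [le_abs_self C₁, le_abs_self C₂, abs_nonneg C₁, abs_nonneg C₂]

end HyperbolicData

/-! ### Replacing m‖mα‖ by the value of the form. -/

theorem Real.abs_rpow_neg_sub_rpow_neg_le {θ x y z : ℝ} (hθ : 0 < θ) (hz : 0 < z) (hx : z ≤ x)
    (hy : z ≤ y) : |x ^ (-θ) - y ^ (-θ)| ≤ θ * z ^ (-θ - 1) * |x - y| := by
  have := (convex_Ici z).norm_image_sub_le_of_norm_hasDerivWithin_le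
    (f := fun t : ℝ => t ^ (-θ)) (f' := fun t => -θ * t ^ (-θ - 1)) (C := θ * z ^ (-θ - 1))
    (fun t ht => (Real.hasDerivAt_rpow_const (Or.inl (hz.trans_le ht).ne')).hasDerivWithinAt)
    (fun t ht => by
      have ht0 : 0 < t := hz.trans_le ht
      rw [Real.norm_eq_abs, abs_mul, abs_neg, abs_of_pos hθ, abs_of_pos (by positivity)]
      gcongr ?_ * ?_
      exact Real.rpow_le_rpow_of_nonpos hz ht (by linarith)) hy hx
  simpa [Real.norm_eq_abs] using this

namespace HyperbolicData

variable {Q : IntBinaryForm} {α α' ε : ℝ} {U : AddAut (ℤ × ℤ)} {P : Set (ℤ × ℤ)}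

/-- With X = mδ and Y = δη/κ = |Q|/(aκ), |X - Y| ≤ δ²/κ = X²/(κm²). The mean value bound on [cX, ∞)
gives a multiple of X^(1-θ)/m², and X^(1-θ) is bounded because X ≥ b and θ > 1. -/
theorem exists_abs_term_sub_le (h : HyperbolicData Q α α' ε U P) {θ : ℝ} (hθ : 1 < θ) :
    ∃ C, ∀ m : ℕ, 1 ≤ m →
      |1 / ((m : ℝ) ^ θ * distNearestInt ((m : ℝ) * α) ^ θ) -
        (Q.a * |α - α'|) ^ θ *
          |(Q.eval (nearPoint α m).1 (nearPoint α m).2 : ℝ)| ^ (-θ)| ≤ C * (1 / (m : ℝ) ^ 2) := by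
  have ha : (1 : ℝ) ≤ Q.a := by exact_mod_cast h.a_pos
  set a : ℝ := (Q.a : ℝ)
  set κ := |α - α'| with hκ
  have hκ0 : 0 < κ := abs_pos.2 (sub_ne_zero.2 h.ne)
  -- Chosen so that both X and Y are at least cX. For κm ≥ 1, η ≥ κm - 1/2 ≥ κm/2; for κm ≤ 1, |Q| ≥
  -- 1 and δ ≤ 1/2 give η ≥ 2/a.
  set c := min 1 (min (1 / 2) (2 / a)) with hc
  have hc0 : 0 < c := by positivity
  -- Lower bound for m‖mα‖, from |Q| ≥ 1 and η ≤ (1/2 + κ)m.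
  set b := 1 / (a * (1 / 2 + κ)) with hb
  have hb0 : 0 < b := by positivity
  refine ⟨θ * c ^ (-θ - 1) * b ^ (1 - θ) / κ, fun m hm => ?_⟩
  have hm1 : (1 : ℝ) ≤ m := by exact_mod_cast hm
  have hm0 : (0 : ℝ) < m := by linarith
  have hq0 := nearPoint_ne_zero α hm
  have hQ1 := h.one_le_abs_eval hq0
  have hη := abs_pos.2 (linForm_ne_zero h.irrational' hq0)
  have hξ := abs_pos.2 (linForm_ne_zero h.irrational hq0)
  have hηle := abs_linForm_nearPoint_le α α' (m := m)
  have hsub := linForm_sub_linForm α α' (nearPoint α m)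
  have hdiff : |(|linForm α' (nearPoint α m)| - κ * m)| ≤ |linForm α (nearPoint α m)| := by
    have e : κ * m = |(α - α') * ((nearPoint α m).2 : ℝ)| := by
      rw [abs_mul]; simp [nearPoint, hκ]
    rw [e, ← hsub]
    refine (abs_abs_sub_abs_le_abs_sub _ _).trans (le_of_eq ?_)
    congr 1; ring
  rw [h.abs_eval_eq] at hQ1 ⊢
  have hδ : |linForm α (nearPoint α m)| ≤ 1 / 2 := by
    rw [abs_linForm_nearPoint]; exact abs_sub_round _
  rw [← abs_linForm_nearPoint]
  set δ := |linForm α (nearPoint α m)|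
  set η := |linForm α' (nearPoint α m)|
  rw [← hκ] at hηle
  have hbX : b ≤ m * δ := by
    rw [hb, div_le_iff₀ (by positivity)]
    calc 1 ≤ a * δ * η := hQ1
      _ ≤ a * δ * (1 / 2 * m + m * κ) := by gcongr; linarith
      _ = _ := by ring
  have hηc : c * (κ * m) ≤ η := by
    rcases le_total (κ * m) 1 with hs | hs
    · have h1 : 2 / a ≤ η := by
        rw [div_le_iff₀ (by positivity)]
        have : a * δ * η ≤ a * (1 / 2) * η := by gcongr
        linarith
      have h2 : c ≤ 2 / a := (min_le_right _ _).trans (min_le_right _ _)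
      calc c * (κ * m) ≤ c * 1 := by gcongr
        _ ≤ η := by linarith
    · have h2 : c ≤ 1 / 2 := (min_le_right _ _).trans (min_le_left _ _)
      have h3 : c * (κ * m) ≤ 1 / 2 * (κ * m) := by gcongr
      have := (abs_le.1 hdiff).1
      linarith
  set X := (m : ℝ) * δ with hX
  have hX0 : 0 < X := by positivity
  set Y := δ * η / κ with hY
  have hXY : |X - Y| ≤ X ^ 2 * (1 / m ^ 2) / κ := by
    have e : X - Y = -(δ * (η - κ * m) / κ) := by rw [hX, hY]; field_simp; ring
    have e2 : X ^ 2 * (1 / m ^ 2) / κ = δ * δ / κ := by rw [hX]; field_simp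
    rw [e, e2, abs_neg, abs_div, abs_mul, abs_of_pos hκ0, abs_of_pos hξ]
    gcongr
  have hcX : c * X ≤ X := mul_le_of_le_one_left hX0.le (min_le_left _ _)
  have hcY : c * X ≤ Y := by
    rw [hX, hY, le_div_iff₀ hκ0]
    calc c * (m * δ) * κ = δ * (c * (κ * m)) := by ring
      _ ≤ δ * η := by gcongr
  have t1 : 1 / ((m : ℝ) ^ θ * δ ^ θ) = X ^ (-θ) := by
    rw [hX, Real.rpow_neg (by positivity), Real.mul_rpow hm0.le hξ.le, one_div]
  have t2 : (a * κ) ^ θ * (a * δ * η) ^ (-θ) = Y ^ (-θ) := by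
    have : Y = a * δ * η / (a * κ) := by rw [hY]; field_simp
    rw [this, Real.div_rpow (by positivity) (by positivity),
      Real.rpow_neg (x := a * κ) (by positivity), div_inv_eq_mul, mul_comm]
  rw [t1, t2]
  calc |X ^ (-θ) - Y ^ (-θ)| ≤ θ * (c * X) ^ (-θ - 1) * |X - Y| :=
        Real.abs_rpow_neg_sub_rpow_neg_le (by linarith) (by positivity) hcX hcY
    _ ≤ θ * (c * X) ^ (-θ - 1) * (X ^ 2 * (1 / m ^ 2) / κ) := by gcongr
    _ = θ * c ^ (-θ - 1) * (X ^ (-θ - 1) * X ^ (2 : ℝ)) / κ * (1 / m ^ 2) := by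
        rw [Real.mul_rpow hc0.le hX0.le, Real.rpow_two]; ring
    _ = θ * c ^ (-θ - 1) * X ^ (1 - θ) / κ * (1 / m ^ 2) := by
        rw [← Real.rpow_add hX0]; congr 4; ring
    _ ≤ θ * c ^ (-θ - 1) * b ^ (1 - θ) / κ * (1 / m ^ 2) := by
        have := Real.rpow_le_rpow_of_nonpos hb0 hbX (z := 1 - θ) (by linarith)
        gcongr

theorem exists_abs_sum_sub_le (h : HyperbolicData Q α α' ε U P) {θ : ℝ} (hθ : 1 < θ) :
    ∃ C, ∀ M : ℕ, |∑ m ∈ Finset.Icc 1 M, 1 / ((m : ℝ) ^ θ * distNearestInt ((m : ℝ) * α) ^ θ) -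
        (Q.a * |α - α'|) ^ θ * ∑ m ∈ Finset.Icc 1 M,
          |(Q.eval (nearPoint α m).1 (nearPoint α m).2 : ℝ)| ^ (-θ)| ≤ C := by
  obtain ⟨C, hC⟩ := h.exists_abs_term_sub_le hθ
  have hC0 : 0 ≤ C := by
    have := (abs_nonneg _).trans (hC 1 le_rfl)
    simpa using this
  have hs : Summable fun m : ℕ => C * (1 / (m : ℝ) ^ 2) :=
    (Real.summable_one_div_nat_pow.2 one_lt_two).mul_left C
  refine ⟨∑' m : ℕ, C * (1 / (m : ℝ) ^ 2), fun M => ?_⟩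
  rw [Finset.mul_sum, ← Finset.sum_sub_distrib]
  refine (Finset.abs_sum_le_sum_abs _ _).trans ((Finset.sum_le_sum fun m hm => hC m
    (Finset.mem_Icc.1 hm).1).trans (hs.sum_le_tsum _ fun m _ => by positivity))

/-! ### Summation over orbits. -/

/-- The orbit decomposition of the sum over the points nearest to the line. -/
theorem exists_abs_sum_nearPoint_sub_le (h : HyperbolicData Q α α' ε U P) {θ : ℝ} (hθ : 1 < θ) :
    ∃ C, ∀ M : ℕ, 1 ≤ M →
      |∑ m ∈ Finset.Icc 1 M, |(Q.eval (nearPoint α m).1 (nearPoint α m).2 : ℝ)| ^ (-θ) -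
        Real.log M / Real.log ε * ∑' p : P, |(Q.eval p.1.1 p.1.2 : ℝ)| ^ (-θ)| ≤ C := by
  classical
  obtain ⟨C, hC⟩ := h.exists_abs_card_meets_sub_le
  have hrep : ∀ m : ℕ, ∃ p : P, 1 ≤ m → Meets α U p m := by
    intro m
    by_cases hm : 1 ≤ m
    · obtain ⟨p, hp, hj⟩ := h.fundamental.exists_rep _ (nearPoint_ne_zero α hm)
      exact ⟨⟨p, hp⟩, fun _ => hj⟩
    -- For m = 0 the nearest point is the origin, which has no representative; any element of `P`
    -- serves as a default.
    · obtain ⟨p, hp, -⟩ := h.fundamental.exists_rep (1, 0) (by simp)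
      exact ⟨⟨p, hp⟩, fun h => absurd h hm⟩
  choose rep hrep using hrep
  have heval : ∀ m : ℕ, 1 ≤ m → |(Q.eval (nearPoint α m).1 (nearPoint α m).2 : ℝ)| =
      |(Q.eval (rep m).1.1 (rep m).1.2 : ℝ)| := by
    intro m hm
    obtain ⟨j, hj⟩ := hrep m hm
    have hε : 0 < ε := by linarith [h.one_lt]
    have e1 : |linForm α ((j • U) (rep m))| = |linForm α (nearPoint α m)| := by
      rcases hj with hj | hj <;> simp [hj, linForm_neg]
    have e2 : |linForm α' ((j • U) (rep m))| = |linForm α' (nearPoint α m)| := by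
      rcases hj with hj | hj <;> simp [hj, linForm_neg]
    rw [h.abs_eval_eq, h.abs_eval_eq, ← e1, ← e2, linForm_zpow (by positivity) h.contract,
      linForm_zpow (by positivity) h.expand, abs_mul, abs_mul, inv_zpow,
      abs_of_pos (zpow_pos hε j), abs_of_pos (inv_pos.2 (zpow_pos hε j))]
    field_simp
  have hiff : ∀ p : P, ∀ m : ℕ, 1 ≤ m → (rep m = p ↔ Meets α U p m) := by
    intro p m hm
    refine ⟨fun e => e ▸ hrep m hm, fun ⟨j, hj⟩ => ?_⟩
    obtain ⟨i, hi⟩ := hrep m hm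
    apply Subtype.ext
    refine h.fundamental.unique_rep _ (rep m).2 _ p.2 (-j + i) ?_
    have e : ∀ x, ((-j + i) • U) x = ((-j) • U) ((i • U) x) := fun x => by
      rw [add_zsmul, AddAut.add_apply]
    have e' : ((-j) • U) ((j • U) p.1) = p.1 := by
      rw [← AddAut.add_apply, ← add_zsmul, neg_add_cancel, zero_zsmul, AddAut.zero_apply]
    rw [e]
    rcases hi with hi | hi <;> rcases hj with hj | hj
    · left; rw [hi, ← hj, e']
    · right; rw [hi, ← neg_eq_iff_eq_neg.2 hj, map_neg, e']
    · right; rw [hi, ← hj, map_neg, e']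
    · left; rw [hi, ← hj, e']
  set f : P → ℝ := fun p => |(Q.eval p.1.1 p.1.2 : ℝ)| ^ (-θ) with hf
  have hf0 : ∀ p, 0 ≤ f p := fun p => by positivity
  have hbd := (h.summable_rpow_mul_log hθ).mul_left C
  -- Summing the counting errors against |Q|^(-θ) gives a convergent series independent of M.
  refine ⟨∑' p : P, C * (f p * (1 + Real.log |(Q.eval p.1.1 p.1.2 : ℝ)|)), fun M hM => ?_⟩
  set N : P → ℝ := fun p => (((Finset.Icc 1 M).filter (Meets α U p)).card : ℝ) with hN
  set L := Real.log M / Real.log ε with hL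
  have hNL : ∀ p : P, |f p * (N p - L)| ≤
      C * (f p * (1 + Real.log |(Q.eval p.1.1 p.1.2 : ℝ)|)) := by
    intro p
    rw [abs_mul, abs_of_nonneg (hf0 p)]
    calc f p * |N p - L| ≤ f p * (C * (1 + Real.log |(Q.eval p.1.1 p.1.2 : ℝ)|)) :=
          mul_le_mul_of_nonneg_left (hC p p.2 M hM) (hf0 p)
      _ = _ := by ring
  have hs1 : Summable fun p : P => f p * (N p - L) := hbd.of_norm_bounded hNL
  have hs2 : Summable fun p : P => f p * L := (h.summable_rpow hθ).mul_right L
  -- Group the m by representative: the fibre over p has N p elements, and N p vanishes for all but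
  -- finitely many p.
  have hsum : ∑ m ∈ Finset.Icc 1 M, |(Q.eval (nearPoint α m).1 (nearPoint α m).2 : ℝ)| ^ (-θ) =
      ∑' p : P, f p * N p := by
    have hfil : ∀ p : P, (Finset.Icc 1 M).filter (fun m => rep m = p) =
        (Finset.Icc 1 M).filter (Meets α U p) := fun p =>
      Finset.filter_congr fun m hm => hiff p m (Finset.mem_Icc.1 hm).1
    rw [tsum_eq_sum (s := (Finset.Icc 1 M).image rep)]
    · rw [Finset.sum_congr rfl fun m hm => show _ = f (rep m) by
        rw [heval m (Finset.mem_Icc.1 hm).1], Finset.sum_comp]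
      refine Finset.sum_congr rfl fun p _ => ?_
      rw [hfil, nsmul_eq_mul, mul_comm]
    · intro p hp
      have : (Finset.Icc 1 M).filter (fun m => rep m = p) = ∅ := by
        rw [Finset.filter_eq_empty_iff]
        exact fun m hm e => hp (Finset.mem_image.2 ⟨m, hm, e⟩)
      rw [hN]
      beta_reduce
      rw [← hfil, this]
      simp
  rw [hsum, mul_comm, ← tsum_mul_right, ← Summable.tsum_sub ?_ hs2]
  · simp_rw [← mul_sub]
    exact (norm_tsum_le_tsum_norm hs1.norm).trans (hs1.norm.tsum_le_tsum hNL hbd)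
  · refine (hs1.add hs2).congr fun p => ?_
    ring

end HyperbolicData

/-! ### The series in R_Q(n) and the final assembly. -/

namespace IntBinaryForm

/-- Summing over primary points is the same as summing over the values of the form, weighted by
the number of primary representations. -/
theorem hasSum_primaryCount (Q : IntBinaryForm) {ε θ : ℝ}
    (hne : ∀ p ∈ Q.primarySet ε, Q.eval p.1 p.2 ≠ 0)
    (hfin : ∀ n : ℤ, (Q.primaryReps ε n).Finite)
    (hs : Summable fun p : Q.primarySet ε => |(Q.eval p.1.1 p.1.2 : ℝ)| ^ (-θ)) :
    HasSum (fun n : {n : ℤ // n ≠ 0} => (Q.primaryCount ε n.1 : ℝ) / |(n.1 : ℝ)| ^ θ)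
      (∑' p : Q.primarySet ε, |(Q.eval p.1.1 p.1.2 : ℝ)| ^ (-θ)) := by
  set g : Q.primarySet ε → {n : ℤ // n ≠ 0} := fun p => ⟨Q.eval p.1.1 p.1.2, hne p p.2⟩ with hg
  have h1 := (Equiv.sigmaFiberEquiv g).hasSum_iff.2 hs.hasSum
  refine h1.sigma fun n => ?_
  have e : {p // g p = n} ≃ Q.primaryReps ε n :=
    { toFun := fun p => ⟨p.1.1, congrArg Subtype.val p.2, p.1.2⟩
      invFun := fun p => ⟨⟨p.1, p.2.2⟩, Subtype.ext p.2.1⟩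
      left_inv := fun _ => rfl
      right_inv := fun _ => rfl }
  have : Fintype (Q.primaryReps ε n) := (hfin n).fintype
  have : Fintype {p // g p = n} := Fintype.ofEquiv _ e.symm
  have hc : Fintype.card {p // g p = n} = Q.primaryCount ε n := by
    rw [Fintype.card_congr e, primaryCount, Set.ncard_eq_toFinset_card', Set.toFinset_card]
  convert hasSum_fintype _ using 1
  rw [Finset.sum_congr rfl fun (p : {p // g p = n}) _ =>
    show _ = |((n : ℤ) : ℝ)| ^ (-θ) by
      have := congrArg Subtype.val p.2
      simp only [hg] at this
      simp only [Function.comp_apply, Equiv.sigmaFiberEquiv_apply, this]]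
  rw [Finset.sum_const, Finset.card_univ, hc, nsmul_eq_mul, Real.rpow_neg (abs_nonneg _),
    div_eq_mul_inv]

/-- α may be either root, whereas the primary set is tied to a fixed ordering of them; for `rootNeg`
the two factors are swapped and `U` is inverted. -/
theorem exists_hyperbolicData (Q : IntBinaryForm) {α : ℝ} (hα : Irrational α) (ha : 0 < Q.a)
    (hroot : (Q.a : ℝ) * α ^ 2 + (Q.b : ℝ) * α + (Q.c : ℝ) = 0) {t u : ℤ}
    (h : IsSmallestPellSolution Q.disc t u) :
    ∃ (α' : ℝ) (U : AddAut (ℤ × ℤ)),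
      HyperbolicData Q α α' (pellUnit Q.disc t u) U (Q.primarySet (pellUnit Q.disc t u)) ∧
      Q.a * |α - α'| = √(Q.disc : ℝ) := by
  have ha' : (0 : ℝ) < Q.a := by exact_mod_cast ha
  have hD := Q.disc_pos hα ha hroot
  have hs := Q.irrational_sqrt_disc hα ha hroot
  have hε := one_lt_pellUnit hD h
  obtain ⟨U, hU, hU'⟩ := Q.exists_automorph ha hD h.1.2.2
  set ε := pellUnit Q.disc t u
  have hε0 : 0 < ε := by linarith
  have hfund := Q.isFundamentalSet_primarySet ha hs hε (U := U) hU hU'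
  have hdiff := Q.rootPos_sub_rootNeg ha
  have hsqrt : 0 < √(Q.disc : ℝ) := Real.sqrt_pos.2 (by exact_mod_cast hD)
  have hlt : 0 < Q.rootPos - Q.rootNeg := by
    rw [← hdiff] at hsqrt
    exact pos_of_mul_pos_right hsqrt ha'.le
  have hne0 : ∀ p ∈ Q.primarySet ε, p ≠ 0 := by
    rintro p hp rfl
    have := ((Q.mem_primarySet_iff ha _).1 hp).1
    simp [linForm] at this
  -- The lower bound 1 on the ratio is weakened to ε^(-2), so that the pair of inequalities is
  -- symmetric in the two roots.
  have hle : ∀ p ∈ Q.primarySet ε, |linForm Q.rootPos p| ≤ ε ^ 2 * |linForm Q.rootNeg p| :=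
    fun p hp => ((Q.mem_primarySet_iff ha _).1 hp).2.1.trans
      (le_mul_of_one_le_left (abs_nonneg _) (one_le_pow₀ hε.le))
  have hle' : ∀ p ∈ Q.primarySet ε, |linForm Q.rootNeg p| ≤ ε ^ 2 * |linForm Q.rootPos p| :=
    fun p hp => ((Q.mem_primarySet_iff ha _).1 hp).2.2.le
  rcases Q.root_eq ha hroot with rfl | rfl
  · refine ⟨Q.rootNeg, U, ⟨ha, hα, Q.irrational_rootNeg ha hs, by linarith,
      Q.eval_eq ha hD, hε, hU, hU', hfund, hne0, hle, hle'⟩, ?_⟩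
    rw [abs_of_pos hlt, hdiff]
  · have hV : ∀ p, U ((-U) p) = p := fun p => by
      rw [← AddAut.add_apply, add_neg_cancel, AddAut.zero_apply]
    refine ⟨Q.rootPos, -U, ⟨ha, hα, Q.irrational_rootPos ha hs, by linarith,
      fun p => by rw [Q.eval_eq ha hD]; ring, hε, fun p => ?_, fun p => ?_, hfund.inv, hne0,
      hle', hle⟩, ?_⟩
    · have := hU' ((-U) p)
      rw [hV] at this
      rw [this, inv_mul_cancel_left₀ hε0.ne']
    · have := hU ((-U) p)
      rw [hV] at this
      rw [this, mul_inv_cancel_left₀ hε0.ne']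
    · rw [abs_sub_comm, abs_of_pos hlt, hdiff]

end IntBinaryForm

theorem mainTheorem4 (α : ℝ) (hα : IsQuadraticIrrational α) (Q : IntBinaryForm)
    (ha : 0 < Q.a) (hgcd : Int.gcd (Int.gcd Q.a Q.b) Q.c = 1)
    (hroot : (Q.a : ℝ) * α ^ 2 + (Q.b : ℝ) * α + (Q.c : ℝ) = 0)
    (θ : ℝ) (hθ : 1 < θ) :
    0 < Q.disc ∧
    ∃ t₀ u₀ : ℤ, IsSmallestPellSolution Q.disc t₀ u₀ ∧
      (∀ n : ℤ, n ≠ 0 → (Q.primaryReps (pellUnit Q.disc t₀ u₀) n).Finite) ∧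
      (Summable fun n : {n : ℤ // n ≠ 0} =>
        (Q.primaryCount (pellUnit Q.disc t₀ u₀) n.1 : ℝ) / |(n.1 : ℝ)| ^ θ) ∧
      ∃ C : ℝ, ∀ M : ℕ, 1 ≤ M →
        |(∑ m ∈ Finset.Icc 1 M, 1 / ((m : ℝ) ^ θ * distNearestInt ((m : ℝ) * α) ^ θ)) -
          Q.diophantineConst (pellUnit Q.disc t₀ u₀) θ * Real.log M| ≤ C := by
  have hirr := hα.irrational
  have hD := Q.disc_pos hirr ha hroot
  obtain ⟨t, u, htu⟩ :=
    exists_isSmallestPellSolution hD (Q.irrational_sqrt_disc hirr ha hroot)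
  obtain ⟨α', U, h, hκ⟩ := Q.exists_hyperbolicData hirr ha hroot htu
  have hsum := Q.hasSum_primaryCount (fun p hp => h.eval_ne_zero (h.ne_zero p hp))
    h.finite_reps (h.summable_rpow hθ)
  refine ⟨hD, t, u, htu, fun n _ => h.finite_reps n, hsum.summable, ?_⟩
  obtain ⟨C₁, h₁⟩ := h.exists_abs_sum_sub_le hθ
  obtain ⟨C₂, h₂⟩ := h.exists_abs_sum_nearPoint_sub_le hθ
  -- The factor (aκ)^θ is √D^θ, the power of D in the constant.
  have hDθ : √(Q.disc : ℝ) ^ θ = (Q.disc : ℝ) ^ (θ / 2) := by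
    rw [Real.sqrt_eq_rpow, ← Real.rpow_mul (by exact_mod_cast hD.le)]
    congr 1; ring
  rw [hκ, hDθ] at h₁
  have hpos : 0 < (Q.disc : ℝ) ^ (θ / 2) := Real.rpow_pos_of_pos (by exact_mod_cast hD) _
  refine ⟨C₁ + (Q.disc : ℝ) ^ (θ / 2) * C₂, fun M hM => ?_⟩
  have e₁ := h₁ M
  have e₂ := mul_le_mul_of_nonneg_left (h₂ M hM) hpos.le
  rw [← abs_of_pos hpos, ← abs_mul, abs_of_pos hpos] at e₂
  rw [IntBinaryForm.diophantineConst, hsum.tsum_eq]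
  refine le_trans (le_of_eq ?_) ((abs_add_le _ _).trans (add_le_add e₁ e₂))
  congr 1
  ring
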